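/- Let $F$ be the free group on two generators and let $M = F/F''$ be the (discrete) free metabelian group of rank $2$, where $F''$ is the second derived subgroup of $F$. For a group $B$ and a characteristic subgroup $K \le B$ of finite index, put $\Gamma[K] := \ker\bigl(\operatorname{Aut}(B) \to \operatorname{Aut}(B/K)\bigr)$. One says that $\operatorname{Aut}(B)$ has the congruence subgroup property if every finite index subgroup of $\operatorname{Aut}(B)$ contains $\Gamma[K]$ for some characteristic subgroup $K$ of finite index in $B$. Then $\operatorname{Aut}(M)$ does not have the congruence subgroup property. That is, there is a finite index subgroup of $\operatorname{Aut}(M)$ which contains $\Gamma[K]$ for no characteristic subgroup $K$ of finite index in $M$. -/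

import Mathlib

/-- The free metabelian group `M = F / F''` of rank 2, where `F` is the free group on two generators
and `F''` is the commutator subgroup of the commutator subgroup of `F`. -/
abbrev FreeMetabelianGroupTwo : Type :=
  FreeGroup (Fin 2) ⧸ derivedSeries (FreeGroup (Fin 2)) 2

/-- The natural homomorphism `Aut(B) → Aut(B / K)` for a characteristic subgroup `K` of `B`,
where the automorphism of `B / K` induced by `φ` sends `bK` to `φ(b)K`. -/
def autQuotientHom {B : Type*} [Group B] (K : Subgroup B) [hK : K.Characteristic] :
    MulAut B →* MulAut (B ⧸ K) where
  toFun φ := QuotientGroup.congr K K φ (Subgroup.characteristic_iff_map_eq.mp hK φ)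
  map_one' := by
    ext x
    obtain ⟨b, rfl⟩ := QuotientGroup.mk_surjective x
    rfl
  map_mul' φ ψ := by
    ext x
    obtain ⟨b, rfl⟩ := QuotientGroup.mk_surjective x
    rfl

/-- The principal congruence subgroup `Γ[K] = ker (Aut(B) → Aut(B / K))` of `Aut(B)`. -/
def principalCongruenceSubgroup {B : Type*} [Group B] (K : Subgroup B) [K.Characteristic] :
    Subgroup (MulAut B) :=
  (autQuotientHom K).ker

/-- `Aut(B)` has the congruence subgroup property: every finite index subgroup of `Aut(B)` contains
`Γ[K]` for some finite index characteristic subgroup `K` of `B`. -/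
def AutHasCongruenceSubgroupProperty (B : Type*) [Group B] : Prop :=
  ∀ H : Subgroup (MulAut B), H.FiniteIndex →
    ∃ (K : Subgroup B) (_ : K.Characteristic), K.FiniteIndex ∧ principalCongruenceSubgroup K ≤ H

/-!
Write `M` for the free metabelian group on `x, y`. Its automorphisms act on `M / M' = ℤ²`, and the
finite index subgroup of `Aut(M)` to be found is the preimage of a noncongruence subgroup `L` of
`SL₂(ℤ)`. It remains to see that the image in `GL₂(ℤ)` of every `Γ[K]` contains the principal
congruence subgroup `Γ(N)` of `SL₂(ℤ)`, for some `N`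
(`FreeMetabelianGroupTwo.exists_Gamma_le_map_principalCongruenceSubgroup`).

Elementary matrices, hence all matrices in `SL₂(ℤ)`, lift to automorphisms of `M` that fix the
commutator `c = ⁅x, y⁆` (`FreeMetabelianGroupTwo.exists_aut_of_specialLinearGroup`). As a module
over `ℤ[ℤ²] = ℤ[X^{±1}, Y^{±1}]`, the commutator subgroup `M'` is generated by `c`. For a lift `φ`
of a matrix congruent to `1` modulo `N`, one has `φ x ≡ x * (a • c)` and `φ y ≡ y * (b • c)` up to
`N`-th powers. The equation `⁅φ x, φ y⁆ = c`, compared by means of the Fox derivative `∂/∂x`, then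
becomes a Koszul relation `(Y - 1) * (X * a) - (X - 1) * (Y * b) = 0` modulo an ideal
`(e, X ^ m - 1, Y ^ m - 1)` (`FreeMetabelianGroupTwo.koszul_relation_of_commutator_eq`). Exactness
of the Koszul complex fails modulo such an ideal, but only by multiples of norm elements
`1 + X + ⋯ + X ^ (m - 1)`, which vanish when `m` is replaced by `m / e`
(`LaurentTwo.exists_of_koszul_relation_mem`). So at the price of a few factors `e` in `N` there is
an `r` such that `φ` agrees modulo `K` with conjugation by `r • c`; composing with the inverse of
this inner automorphism, which acts trivially on `ℤ²`, gives an element of `Γ[K]`.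

For `L`, Sanov's matrices `!![1, 2; 0, 1]` and `!![1, 0; 2, 1]` freely generate a subgroup which
together with `-1` generates `Γ(2)`; take the kernel of the character sending the first to `1` and
the second to `0` modulo `5`. If `L` contained `Γ(m)`, where `10 ∣ m` may be assumed, then for `u`
prime to `m` the character would take the same value on `!![1, 2; 0, 1]` and on its `u ^ 2`-th
power, which is conjugate to it modulo `m` by a lift of `diag(u, u⁻¹)`; this is absurd for
`u ≡ 2` modulo `5`.
-/

open scoped commutatorElement

/-! ### The group ring of `ℤ²` -/

/-- The free abelian group of rank two, written multiplicatively. -/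
abbrev FreeAbelianTwo : Type := Multiplicative ℤ × Multiplicative ℤ

/-- The group ring of `ℤ²`, that is, the ring of integral Laurent polynomials in two variables. -/
abbrev LaurentTwo : Type := MonoidAlgebra ℤ FreeAbelianTwo

namespace LaurentTwo

/-- The first variable. -/
noncomputable def X : LaurentTwo := MonoidAlgebra.of ℤ _ (Multiplicative.ofAdd 1, 1)

/-- The second variable. -/
noncomputable def Y : LaurentTwo := MonoidAlgebra.of ℤ _ (1, Multiplicative.ofAdd 1)

theorem intCast_dvd_iff {G : Type*} [Monoid G] (n : ℤ) (b : MonoidAlgebra ℤ G) :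
    (n : MonoidAlgebra ℤ G) ∣ b ↔ ∀ g, n ∣ b.coeff g := by
  have key : ∀ c : MonoidAlgebra ℤ G, ∀ g,
      ((n : MonoidAlgebra ℤ G) * c).coeff g = n * c.coeff g := by
    intro c g
    rw [← zsmul_eq_mul, MonoidAlgebra.coeff_smul_apply, smul_eq_mul]
  constructor
  · rintro ⟨c, rfl⟩ g
    exact ⟨_, key c g⟩
  · intro h
    refine ⟨MonoidAlgebra.ofCoeff (b.coeff.mapRange (· / n) (by simp)), ?_⟩
    ext g
    rw [key]
    simp [Int.mul_ediv_cancel' (h g)]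

/-- If `w` has infinite order, then `w - 1` is a nonzerodivisor in the group ring modulo every
integer `n` (including `n = 0`): modulo `n`, the coefficients of an element annihilated by `w - 1`
are constant along the orbits of `w`, which are infinite. -/
theorem intCast_dvd_of_dvd_sub_one_mul {G : Type*} [Group G] {w : G}
    (hw : Function.Injective fun k : ℕ => w ^ k) {n : ℤ} {b : MonoidAlgebra ℤ G}
    (h : (n : MonoidAlgebra ℤ G) ∣ (MonoidAlgebra.of ℤ G w - 1) * b) :
    (n : MonoidAlgebra ℤ G) ∣ b := by
  rw [intCast_dvd_iff] at h ⊢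
  have step : ∀ g, n ∣ b.coeff (w⁻¹ * g) - b.coeff g := by
    intro g
    have := h g
    rw [sub_mul, one_mul, MonoidAlgebra.of_apply] at this
    simpa [MonoidAlgebra.coeff_single_mul_apply] using this
  intro g
  have many : ∀ k : ℕ, n ∣ b.coeff ((w ^ k)⁻¹ * g) - b.coeff g := by
    intro k
    induction k with
    | zero => simp
    | succ k ih =>
      have := dvd_add (step ((w ^ k)⁻¹ * g)) ih
      rwa [sub_add_sub_cancel, ← mul_assoc, ← mul_inv_rev, ← pow_succ] at this
  obtain ⟨k, hk⟩ : ∃ k : ℕ, (w ^ k)⁻¹ * g ∉ b.coeff.support := by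
    by_contra! hcon
    refine Set.infinite_univ (α := ℕ) (Set.Finite.subset
      (Set.Finite.preimage (f := fun k : ℕ => (w ^ k)⁻¹ * g) ?_ b.coeff.support.finite_toSet)
      fun k _ => hcon k)
    intro i _ j _ hij
    exact hw (inv_injective (mul_right_cancel hij))
  have := many k
  rw [Finsupp.notMem_support_iff.mp hk, zero_sub] at this
  simpa using this

theorem intCast_dvd_of_dvd_X_sub_one_mul {n : ℤ} {b : LaurentTwo}
    (h : (n : LaurentTwo) ∣ (X - 1) * b) : (n : LaurentTwo) ∣ b := by
  refine intCast_dvd_of_dvd_sub_one_mul (fun i j hij => ?_) h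
  have := congrArg (fun t : FreeAbelianTwo => t.1.toAdd) hij
  simpa using this

theorem intCast_dvd_of_dvd_Y_sub_one_mul {n : ℤ} {b : LaurentTwo}
    (h : (n : LaurentTwo) ∣ (Y - 1) * b) : (n : LaurentTwo) ∣ b := by
  refine intCast_dvd_of_dvd_sub_one_mul (fun i j hij => ?_) h
  have := congrArg (fun t : FreeAbelianTwo => t.2.toAdd) hij
  simpa using this

theorem eq_of_Y_sub_one_mul_eq {a b : LaurentTwo} (h : (Y - 1) * a = (Y - 1) * b) : a = b := by
  have h0 : ((0 : ℤ) : LaurentTwo) ∣ (Y - 1) * (a - b) := by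
    rw [mul_sub, h, sub_self]
    exact dvd_zero _
  simpa [sub_eq_zero] using intCast_dvd_of_dvd_Y_sub_one_mul h0

/-- The substitution `Y = 1`, as an endomorphism. -/
noncomputable def evalYOne : LaurentTwo →+* LaurentTwo :=
  MonoidAlgebra.mapDomainRingHom ℤ
    ((MonoidHom.inl (Multiplicative ℤ) (Multiplicative ℤ)).comp (MonoidHom.fst _ _))

theorem evalYOne_of (t : FreeAbelianTwo) :
    evalYOne (MonoidAlgebra.of ℤ _ t) = MonoidAlgebra.of ℤ _ (t.1, 1) := by
  simp [evalYOne]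

theorem evalYOne_X : evalYOne X = X := evalYOne_of _

theorem evalYOne_Y : evalYOne Y = 1 := by
  rw [Y, evalYOne_of]
  exact map_one _

theorem Y_sub_one_dvd_of_zpow (k : ℤ) :
    Y - 1 ∣ MonoidAlgebra.of ℤ FreeAbelianTwo (1, Multiplicative.ofAdd k) - 1 := by
  have hnat : ∀ k : ℕ,
      Y - 1 ∣ MonoidAlgebra.of ℤ FreeAbelianTwo (1, Multiplicative.ofAdd (k : ℤ)) - 1 := by
    intro k
    have : MonoidAlgebra.of ℤ FreeAbelianTwo (1, Multiplicative.ofAdd (k : ℤ)) = Y ^ k := by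
      rw [Y, ← map_pow]
      congr 1
      ext <;> simp
    rw [this]
    exact sub_one_dvd_pow_sub_one Y k
  obtain ⟨n, rfl | rfl⟩ := k.eq_nat_or_neg
  · exact hnat n
  · have h1 : MonoidAlgebra.of ℤ FreeAbelianTwo (1, Multiplicative.ofAdd (-(n : ℤ)))
        * MonoidAlgebra.of ℤ FreeAbelianTwo (1, Multiplicative.ofAdd (n : ℤ)) = 1 := by
      rw [← map_mul, ← map_one (MonoidAlgebra.of ℤ FreeAbelianTwo)]
      congr 1
      ext <;> simp
    have h2 := (hnat n).mul_left
      (-MonoidAlgebra.of ℤ FreeAbelianTwo (1, Multiplicative.ofAdd (-(n : ℤ))))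
    refine (h2.trans (dvd_of_eq ?_))
    linear_combination -h1

theorem Y_sub_one_dvd_sub_evalYOne (b : LaurentTwo) : Y - 1 ∣ b - evalYOne b := by
  induction b using MonoidAlgebra.induction_on with
  | of t =>
    have : MonoidAlgebra.of ℤ FreeAbelianTwo t =
        MonoidAlgebra.of ℤ _ (t.1, 1) * MonoidAlgebra.of ℤ _ (1, t.2) := by
      rw [← map_mul]
      simp
    rw [evalYOne_of, this, ← mul_sub_one]
    exact (Y_sub_one_dvd_of_zpow t.2.toAdd).mul_left _
  | add a b ha hb =>
    rw [map_add, add_sub_add_comm]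
    exact dvd_add ha hb
  | smul n b hb =>
    rw [map_zsmul, ← zsmul_sub]
    exact hb.mul_left n |>.trans (dvd_of_eq (by simp))

/-- `Y - 1` is a nonzerodivisor modulo the ideal `(n, X ^ m - 1)`, whose generators do not
involve `Y`: the relation survives the substitution `Y = 1`, which makes the left side vanish. -/
theorem exists_of_Y_sub_one_mul_eq {n : ℤ} {m : ℕ} {s p q : LaurentTwo}
    (h : (Y - 1) * s = n * p + (X ^ m - 1) * q) :
    ∃ p' q' : LaurentTwo, s = n * p' + (X ^ m - 1) * q' := by
  obtain ⟨p', hp⟩ := Y_sub_one_dvd_sub_evalYOne p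
  obtain ⟨q', hq⟩ := Y_sub_one_dvd_sub_evalYOne q
  have h0 : (n : LaurentTwo) * evalYOne p + (X ^ m - 1) * evalYOne q = 0 := by
    have := congrArg evalYOne h
    simpa [evalYOne_X, evalYOne_Y] using this.symm
  refine ⟨p', q', eq_of_Y_sub_one_mul_eq ?_⟩
  linear_combination h + n * hp + (X ^ m - 1) * hq + h0

/-- The kernel of the reduction `ℤ[ℤ²] → (ℤ/n)[(ℤ/m)²]`, given by generators. -/
noncomputable def levelIdeal (n m : ℕ) : Ideal LaurentTwo :=
  Ideal.span {(n : LaurentTwo), X ^ m - 1, Y ^ m - 1}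

theorem mem_levelIdeal {n m : ℕ} {s : LaurentTwo} :
    s ∈ levelIdeal n m ↔ ∃ p q r, s = n * p + (X ^ m - 1) * q + (Y ^ m - 1) * r := by
  rw [levelIdeal, Ideal.span, Submodule.mem_span_triple]
  simp only [smul_eq_mul, mul_comm, eq_comm]

theorem natCast_mem_levelIdeal (n m : ℕ) : (n : LaurentTwo) ∈ levelIdeal n m :=
  Ideal.subset_span (by simp)

theorem X_pow_sub_one_mem_levelIdeal (n m : ℕ) : X ^ m - 1 ∈ levelIdeal n m :=
  Ideal.subset_span (by simp)

theorem Y_pow_sub_one_mem_levelIdeal (n m : ℕ) : Y ^ m - 1 ∈ levelIdeal n m :=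
  Ideal.subset_span (by simp)

theorem levelIdeal_le_of_dvd (n : ℕ) {m k : ℕ} (h : m ∣ k) : levelIdeal n k ≤ levelIdeal n m := by
  obtain ⟨l, rfl⟩ := h
  have aux : ∀ t : LaurentTwo, t ^ m - 1 ∈ levelIdeal n m → t ^ (m * l) - 1 ∈ levelIdeal n m := by
    intro t ht
    rw [pow_mul]
    exact Ideal.mem_of_dvd _ (sub_one_dvd_pow_sub_one _ l) ht
  rw [levelIdeal, Ideal.span_le]
  rintro s (rfl | rfl | rfl)
  · exact natCast_mem_levelIdeal _ _
  · exact aux _ (X_pow_sub_one_mem_levelIdeal _ _)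
  · exact aux _ (Y_pow_sub_one_mem_levelIdeal _ _)

/-- Group elements have finite order dividing `m` modulo the ideal of level `m`. -/
theorem of_pow_sub_one_mem_levelIdeal (n m : ℕ) (t : FreeAbelianTwo) :
    MonoidAlgebra.of ℤ _ t ^ m - 1 ∈ levelIdeal n m := by
  let f : FreeAbelianTwo →* LaurentTwo ⧸ levelIdeal n m :=
    ((Ideal.Quotient.mk (levelIdeal n m)).toMonoidHom.comp (MonoidAlgebra.of ℤ _)).comp
      (powMonoidHom m)
  have h1 : f.comp (MonoidHom.inl _ _) = 1 := by
    ext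
    simpa [f, X, map_pow, sub_eq_zero] using
      Ideal.Quotient.eq_zero_iff_mem.mpr (X_pow_sub_one_mem_levelIdeal n m)
  have h2 : f.comp (MonoidHom.inr _ _) = 1 := by
    ext
    simpa [f, Y, map_pow, sub_eq_zero] using
      Ideal.Quotient.eq_zero_iff_mem.mpr (Y_pow_sub_one_mem_levelIdeal n m)
  have hf : f t = 1 := by
    have ht : t = MonoidHom.inl _ _ t.1 * MonoidHom.inr _ _ t.2 := by simp
    rw [ht, map_mul, ← MonoidHom.comp_apply, ← MonoidHom.comp_apply, h1, h2]
    simp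
  rw [← Ideal.Quotient.eq_zero_iff_mem, map_sub, map_one, sub_eq_zero, ← map_pow]
  exact hf

/-- The norm element `1 + w + ⋯ + w ^ (n * m - 1)` of level `n * m` vanishes at level `m`, where it
becomes `n` times the norm element of level `m`. -/
theorem geom_sum_mem_levelIdeal (n m : ℕ) {w : LaurentTwo} (hw : w ^ m - 1 ∈ levelIdeal n m) :
    ∑ i ∈ Finset.range (n * m), w ^ i ∈ levelIdeal n m := by
  have hw' : (Ideal.Quotient.mk (levelIdeal n m) w) ^ m = 1 := by
    rw [← map_pow, ← sub_eq_zero, ← map_one (Ideal.Quotient.mk (levelIdeal n m)), ← map_sub]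
    exact Ideal.Quotient.eq_zero_iff_mem.mpr hw
  have hn : ((n : LaurentTwo ⧸ levelIdeal n m)) = 0 := by
    rw [← map_natCast (Ideal.Quotient.mk (levelIdeal n m))]
    exact Ideal.Quotient.eq_zero_iff_mem.mpr (natCast_mem_levelIdeal n m)
  rw [← Ideal.Quotient.eq_zero_iff_mem, map_sum]
  simp only [map_pow]
  generalize Ideal.Quotient.mk (levelIdeal n m) w = v at hw'
  have : ∀ k : ℕ, ∑ i ∈ Finset.range (k * m), v ^ i = k * ∑ i ∈ Finset.range m, v ^ i := by
    intro k
    induction k with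
    | zero => simp
    | succ k ih =>
      rw [add_mul, one_mul, Finset.sum_range_add, ih]
      simp only [pow_add, mul_comm k m, pow_mul, hw', one_pow, one_mul]
      push_cast
      ring
  rw [this, hn, zero_mul]

theorem mem_levelIdeal_of_Y_sub_one_mul_mem {n m : ℕ} {s : LaurentTwo}
    (h : (Y - 1) * s ∈ levelIdeal n (n * m)) : s ∈ levelIdeal n m := by
  obtain ⟨p, q, r, h⟩ := mem_levelIdeal.mp h
  have hY := mul_geom_sum Y (n * m)
  obtain ⟨p', q', h'⟩ := exists_of_Y_sub_one_mul_eq (n := n) (m := n * m)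
    (s := s - (∑ i ∈ Finset.range (n * m), Y ^ i) * r) (p := p) (q := q) (by
      push_cast
      linear_combination h - r * hY)
  have hX := levelIdeal_le_of_dvd n (Dvd.intro_left n rfl) (X_pow_sub_one_mem_levelIdeal n (n * m))
  have hN := geom_sum_mem_levelIdeal n m (Y_pow_sub_one_mem_levelIdeal n m)
  rw [sub_eq_iff_eq_add.mp h']
  exact add_mem (add_mem (Ideal.mul_mem_right _ _ (by exact_mod_cast natCast_mem_levelIdeal n m))
    (Ideal.mul_mem_right _ _ hX)) (Ideal.mul_mem_right _ _ hN)

/-- Exactness of the Koszul complex of `(X - 1, Y - 1)`, up to a loss of level: the torsion that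
the relations `X ^ (n * m) = 1` and `Y ^ (n * m) = 1` create consists of multiples of norm elements,
and these vanish at level `m`. -/
theorem exists_of_koszul_relation_mem {n m : ℕ} {a b : LaurentTwo}
    (h : (Y - 1) * a + (X - 1) * b ∈ levelIdeal n (n * m)) :
    ∃ c, a + (X - 1) * c ∈ levelIdeal n m ∧ b - (Y - 1) * c ∈ levelIdeal n m := by
  obtain ⟨p, q, r, h⟩ := mem_levelIdeal.mp h
  have hX := mul_geom_sum X (n * m)
  have hY := mul_geom_sum Y (n * m)
  have hNX := geom_sum_mem_levelIdeal n m (X_pow_sub_one_mem_levelIdeal n m)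
  have hNY := geom_sum_mem_levelIdeal n m (Y_pow_sub_one_mem_levelIdeal n m)
  generalize ∑ i ∈ Finset.range (n * m), X ^ i = NX at hX hNX
  generalize ∑ i ∈ Finset.range (n * m), Y ^ i = NY at hY hNY
  -- After subtracting multiples of norm elements, the relation holds modulo `n` alone.
  have h1 : (Y - 1) * (a - NY * r) + (X - 1) * (b - NX * q) = n * p := by
    linear_combination h - r * hY - q * hX
  have hb : ((n : ℤ) : LaurentTwo) ∣ (X - 1) * evalYOne (b - NX * q) := by
    refine ⟨evalYOne p, ?_⟩
    simpa [evalYOne_X, evalYOne_Y] using congrArg evalYOne h1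
  obtain ⟨t, ht⟩ := intCast_dvd_of_dvd_X_sub_one_mul hb
  obtain ⟨c, hc⟩ := Y_sub_one_dvd_sub_evalYOne (b - NX * q)
  have ha : ((n : ℤ) : LaurentTwo) ∣ (Y - 1) * (a - NY * r + (X - 1) * c) := by
    refine ⟨p - (X - 1) * t, ?_⟩
    push_cast at ht ⊢
    linear_combination h1 - (X - 1) * hc - (X - 1) * ht
  obtain ⟨t', ht'⟩ := intCast_dvd_of_dvd_Y_sub_one_mul ha
  push_cast at ht ht'
  have hn := natCast_mem_levelIdeal n m
  refine ⟨c, ?_, ?_⟩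
  · rw [show a + (X - 1) * c = n * t' + NY * r by linear_combination ht']
    exact add_mem (Ideal.mul_mem_right _ _ hn) (Ideal.mul_mem_right _ _ hNY)
  · rw [show b - (Y - 1) * c = n * t + NX * q by linear_combination hc + ht]
    exact add_mem (Ideal.mul_mem_right _ _ hn) (Ideal.mul_mem_right _ _ hNX)

end LaurentTwo

/-! ### The free metabelian group of rank two -/

namespace FreeMetabelianGroupTwo

/-- The first free generator. -/
def x : FreeMetabelianGroupTwo := QuotientGroup.mk (FreeGroup.of 0)

/-- The second free generator. -/
def y : FreeMetabelianGroupTwo := QuotientGroup.mk (FreeGroup.of 1)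

/-- The homomorphism to a metabelian group with prescribed values on the generators. -/
def lift {G : Type*} [Group G] (hG : derivedSeries G 2 = ⊥) (a b : G) :
    FreeMetabelianGroupTwo →* G :=
  QuotientGroup.lift _ (FreeGroup.lift ![a, b]) fun f hf => by
    have := map_derivedSeries_le_derivedSeries (FreeGroup.lift ![a, b]) 2
      (Subgroup.mem_map_of_mem _ hf)
    rwa [hG, Subgroup.mem_bot] at this

section Lift

variable {G : Type*} [Group G] (hG : derivedSeries G 2 = ⊥) (a b : G)

@[simp] theorem lift_x : lift hG a b x = a := by
  change FreeGroup.lift ![a, b] (FreeGroup.of 0) = a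
  simp

@[simp] theorem lift_y : lift hG a b y = b := by
  change FreeGroup.lift ![a, b] (FreeGroup.of 1) = b
  simp

end Lift

theorem hom_ext {G : Type*} [Monoid G] {f g : FreeMetabelianGroupTwo →* G} (hx : f x = g x)
    (hy : f y = g y) : f = g := by
  refine QuotientGroup.monoidHom_ext _ (FreeGroup.ext_hom _ _ fun i => ?_)
  fin_cases i
  · exact hx
  · exact hy

theorem eq_top_of_mem {H : Subgroup FreeMetabelianGroupTwo} (hx : x ∈ H) (hy : y ∈ H) : H = ⊤ := by
  have : (QuotientGroup.mk' (derivedSeries (FreeGroup (Fin 2)) 2)).range ≤ H := by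
    rw [MonoidHom.range_eq_map, ← FreeGroup.closure_range_of, Subgroup.map_le_iff_le_comap,
      Subgroup.closure_le]
    rintro _ ⟨i, rfl⟩
    fin_cases i
    · exact hx
    · exact hy
  rwa [MonoidHom.range_eq_top.mpr (QuotientGroup.mk'_surjective _), top_le_iff] at this

theorem derivedSeries_two_eq_bot_of_ker_commute {G A : Type*} [Group G] [CommGroup A] (f : G →* A)
    (h : ∀ a ∈ f.ker, ∀ b ∈ f.ker, a * b = b * a) : derivedSeries G 2 = ⊥ := by
  have h1 : derivedSeries G 1 ≤ f.ker := by
    rw [derivedSeries_one]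
    exact Abelianization.commutator_subset_ker f
  rw [derivedSeries_succ, eq_bot_iff, Subgroup.commutator_le]
  intro a ha b hb
  rw [Subgroup.mem_bot, commutatorElement_eq_one_iff_mul_comm]
  exact h a (h1 ha) b (h1 hb)

theorem derivedSeries_two_eq_bot_of_comm (A : Type*) [CommGroup A] : derivedSeries A 2 = ⊥ :=
  derivedSeries_two_eq_bot_of_ker_commute (MonoidHom.id A) fun a _ b _ => mul_comm a b

theorem derivedSeries_two : derivedSeries FreeMetabelianGroupTwo 2 = ⊥ := by
  rw [← map_derivedSeries_eq (QuotientGroup.mk'_surjective (derivedSeries (FreeGroup (Fin 2)) 2)),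
    Subgroup.map_eq_bot_iff, QuotientGroup.ker_mk']

theorem commute_of_mem_commutator {a b : FreeMetabelianGroupTwo}
    (ha : a ∈ commutator FreeMetabelianGroupTwo) (hb : b ∈ commutator FreeMetabelianGroupTwo) :
    Commute a b := by
  rw [← derivedSeries_one] at ha hb
  have := Subgroup.commutator_mem_commutator ha hb
  rw [← derivedSeries_succ, derivedSeries_two, Subgroup.mem_bot] at this
  exact commutatorElement_eq_one_iff_mul_comm.mp this

/-- The abelianization map to `ℤ²`. -/
def ab : FreeMetabelianGroupTwo →* FreeAbelianTwo :=
  lift (derivedSeries_two_eq_bot_of_comm _) (Multiplicative.ofAdd 1, 1) (1, Multiplicative.ofAdd 1)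

@[simp] theorem ab_x : ab x = (Multiplicative.ofAdd 1, 1) := lift_x ..

@[simp] theorem ab_y : ab y = (1, Multiplicative.ofAdd 1) := lift_y ..

/-- The section of `ab` with values `x ^ i * y ^ j`; it is not a homomorphism. -/
def abSection (t : FreeAbelianTwo) : FreeMetabelianGroupTwo := x ^ t.1.toAdd * y ^ t.2.toAdd

@[simp] theorem ab_abSection (t : FreeAbelianTwo) : ab (abSection t) = t := by
  simp [abSection]
  ext <;> simp

theorem ker_ab : ab.ker = commutator FreeMetabelianGroupTwo := by
  refine le_antisymm (fun g hg => ?_) (Abelianization.commutator_subset_ker ab)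
  let s : FreeAbelianTwo →* Abelianization FreeMetabelianGroupTwo :=
    MonoidHom.coprod (zpowersHom _ (Abelianization.of x)) (zpowersHom _ (Abelianization.of y))
  have hs : s.comp ab = Abelianization.of := hom_ext (by simp [s]) (by simp [s])
  rw [← Abelianization.ker_of, MonoidHom.mem_ker, ← hs, MonoidHom.comp_apply,
    MonoidHom.mem_ker.mp hg, map_one]

theorem ab_eq_one_of_mem {d : FreeMetabelianGroupTwo}
    (hd : d ∈ commutator FreeMetabelianGroupTwo) : ab d = 1 := by
  rwa [← ker_ab] at hd

/-- Conjugation on the commutator subgroup factors through the abelianization. -/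
theorem conj_eq_of_ab_eq {g h d : FreeMetabelianGroupTwo} (hgh : ab g = ab h)
    (hd : d ∈ commutator FreeMetabelianGroupTwo) : g * d * g⁻¹ = h * d * h⁻¹ := by
  have hk : h⁻¹ * g ∈ commutator FreeMetabelianGroupTwo := by
    rw [← ker_ab, MonoidHom.mem_ker, map_mul, map_inv, hgh, inv_mul_cancel]
  have := (commute_of_mem_commutator hk hd).eq
  calc g * d * g⁻¹ = h * (h⁻¹ * g * d) * g⁻¹ := by group
    _ = h * d * h⁻¹ := by rw [this]; group

/-! ### Fox derivatives -/

/-- The image of a group element in the group ring of the abelianization. -/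
noncomputable def bar : FreeMetabelianGroupTwo →* LaurentTwo := (MonoidAlgebra.of ℤ _).comp ab

@[simp] theorem bar_x : bar x = LaurentTwo.X := by simp [bar, LaurentTwo.X]

@[simp] theorem bar_y : bar y = LaurentTwo.Y := by simp [bar, LaurentTwo.Y]

theorem bar_eq_one_of_mem {d : FreeMetabelianGroupTwo}
    (hd : d ∈ commutator FreeMetabelianGroupTwo) : bar d = 1 := by
  rw [bar, MonoidHom.comp_apply, ab_eq_one_of_mem hd, map_one]

/-- The action of `ℤ²` on its group ring by multiplication. -/
noncomputable def mulAction : FreeAbelianTwo →* MulAut (Multiplicative LaurentTwo) where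
  toFun t :=
    { toFun := fun r => .ofAdd (MonoidAlgebra.of ℤ _ t * r.toAdd)
      invFun := fun r => .ofAdd (MonoidAlgebra.of ℤ _ t⁻¹ * r.toAdd)
      left_inv := fun r => by
        beta_reduce
        rw [toAdd_ofAdd, ← mul_assoc, ← map_mul, inv_mul_cancel, map_one, one_mul, ofAdd_toAdd]
      right_inv := fun r => by
        beta_reduce
        rw [toAdd_ofAdd, ← mul_assoc, ← map_mul, mul_inv_cancel, map_one, one_mul, ofAdd_toAdd]
      map_mul' := fun r s => by rw [toAdd_mul, mul_add, ofAdd_add] }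
  map_one' := by
    ext r : 1
    change Multiplicative.ofAdd (MonoidAlgebra.of ℤ _ 1 * r.toAdd) = r
    rw [map_one, one_mul, ofAdd_toAdd]
  map_mul' t u := by
    ext r : 1
    change Multiplicative.ofAdd (MonoidAlgebra.of ℤ _ (t * u) * r.toAdd) =
      .ofAdd (MonoidAlgebra.of ℤ _ t * (MonoidAlgebra.of ℤ _ u * r.toAdd))
    rw [map_mul (MonoidAlgebra.of ℤ FreeAbelianTwo), mul_assoc]

theorem derivedSeries_two_semidirect :
    derivedSeries (Multiplicative LaurentTwo ⋊[mulAction] FreeAbelianTwo) 2 = ⊥ := by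
  refine derivedSeries_two_eq_bot_of_ker_commute SemidirectProduct.rightHom ?_
  rw [← SemidirectProduct.range_inl_eq_ker_rightHom]
  rintro _ ⟨a, rfl⟩ _ ⟨b, rfl⟩
  rw [← map_mul, mul_comm, map_mul]

/-- The homomorphism to `ℤ[ℤ²] ⋊ ℤ²` whose first component is the Fox derivative. -/
noncomputable def foxHom :
    FreeMetabelianGroupTwo →* Multiplicative LaurentTwo ⋊[mulAction] FreeAbelianTwo :=
  lift derivedSeries_two_semidirect ⟨.ofAdd 1, ab x⟩ ⟨1, ab y⟩

theorem foxHom_right (g : FreeMetabelianGroupTwo) : (foxHom g).right = ab g := by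
  have : SemidirectProduct.rightHom.comp foxHom = ab :=
    hom_ext (by simp [foxHom]) (by simp [foxHom])
  exact DFunLike.congr_fun this g

/-- The Fox derivative `∂/∂x`: the derivation with values in the group ring of the abelianization
that sends `x` to `1` and `y` to `0`. -/
noncomputable def fox (g : FreeMetabelianGroupTwo) : LaurentTwo := (foxHom g).left.toAdd

@[simp] theorem fox_x : fox x = 1 := by simp [fox, foxHom]

@[simp] theorem fox_y : fox y = 0 := by simp [fox, foxHom]

theorem fox_mul (g h : FreeMetabelianGroupTwo) : fox (g * h) = fox g + bar g * fox h := by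
  rw [fox, map_mul, SemidirectProduct.mul_left, toAdd_mul, foxHom_right]
  rfl

@[simp] theorem fox_one : fox 1 = 0 := by simp [fox]

theorem bar_mul_bar_inv (g : FreeMetabelianGroupTwo) : bar g * bar g⁻¹ = 1 := by
  rw [← map_mul, mul_inv_cancel, map_one]

theorem fox_inv (g : FreeMetabelianGroupTwo) : fox g⁻¹ = -(bar g⁻¹ * fox g) := by
  have := fox_mul g⁻¹ g
  rw [inv_mul_cancel, fox_one] at this
  linear_combination -this

theorem fox_conj (g h : FreeMetabelianGroupTwo) :
    fox (g * h * g⁻¹) = (1 - bar h) * fox g + bar g * fox h := by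
  rw [fox_mul, fox_mul, fox_inv, map_mul]
  linear_combination (-bar h * fox g) * bar_mul_bar_inv g

theorem fox_commutator (g h : FreeMetabelianGroupTwo) :
    fox ⁅g, h⁆ = (1 - bar h) * fox g + (bar g - 1) * fox h := by
  rw [commutatorElement_def, fox_mul, fox_conj, fox_inv, map_mul, map_mul]
  linear_combination (-bar h * bar h⁻¹ * fox h) * bar_mul_bar_inv g - fox h * bar_mul_bar_inv h

theorem fox_pow (g : FreeMetabelianGroupTwo) (n : ℕ) :
    fox (g ^ n) = (∑ i ∈ Finset.range n, bar g ^ i) * fox g := by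
  induction n with
  | zero => simp
  | succ n ih => rw [pow_succ, fox_mul, ih, Finset.sum_range_succ, map_pow, add_mul]

/-! ### The commutator subgroup as a module over the group ring -/

/-- The commutator of the two generators. -/
def c : FreeMetabelianGroupTwo := ⁅x, y⁆

theorem c_mem : c ∈ commutator FreeMetabelianGroupTwo :=
  Subgroup.commutator_mem_commutator (Subgroup.mem_top _) (Subgroup.mem_top _)

/-- The commutator subgroup is commutative. -/
instance : CommGroup (commutator FreeMetabelianGroupTwo) :=
  { (inferInstance : Group (commutator FreeMetabelianGroupTwo)) with
    mul_comm := fun a b => Subtype.ext (commute_of_mem_commutator a.2 b.2).eq }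

/-- The additive map `∑ n_t t ↦ ∏ (s_t c s_t⁻¹) ^ n_t`, where `s_t` lifts `t`. -/
noncomputable def moduleHom : LaurentTwo →+ Additive (commutator FreeMetabelianGroupTwo) :=
  (Finsupp.liftAddHom fun t => (zmultiplesHom _ (.ofMul
    (⟨abSection t * c * (abSection t)⁻¹, Subgroup.Normal.conj_mem inferInstance _ c_mem _⟩ :
      commutator FreeMetabelianGroupTwo)))).comp MonoidAlgebra.coeffAddEquiv.toAddMonoidHom

/-- The element `r • c` of the commutator subgroup, where the group ring acts through
conjugation. -/
noncomputable def smulC (r : LaurentTwo) : FreeMetabelianGroupTwo := (moduleHom r).toMul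

theorem smulC_mem (r : LaurentTwo) : smulC r ∈ commutator FreeMetabelianGroupTwo :=
  (moduleHom r).toMul.2

theorem smulC_add (r s : LaurentTwo) : smulC (r + s) = smulC r * smulC s := by
  simp [smulC]

@[simp] theorem smulC_zero : smulC 0 = 1 := by simp [smulC]

theorem smulC_neg (r : LaurentTwo) : smulC (-r) = (smulC r)⁻¹ := by simp [smulC]

theorem smulC_sub (r s : LaurentTwo) : smulC (r - s) = smulC r * (smulC s)⁻¹ := by
  rw [sub_eq_add_neg, smulC_add, smulC_neg]

theorem smulC_zsmul (n : ℤ) (r : LaurentTwo) : smulC (n • r) = smulC r ^ n := by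
  rw [smulC, map_zsmul, toMul_zsmul, Subgroup.coe_zpow, smulC]

theorem smulC_of (t : FreeAbelianTwo) :
    smulC (MonoidAlgebra.of ℤ _ t) = abSection t * c * (abSection t)⁻¹ := by
  simp [smulC, moduleHom]

theorem smulC_bar (g : FreeMetabelianGroupTwo) : smulC (bar g) = g * c * g⁻¹ := by
  rw [bar, MonoidHom.comp_apply, smulC_of]
  exact conj_eq_of_ab_eq (ab_abSection _) c_mem

theorem of_eq_bar (t : FreeAbelianTwo) : MonoidAlgebra.of ℤ _ t = bar (abSection t) := by
  rw [bar, MonoidHom.comp_apply, ab_abSection]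

@[simp] theorem smulC_one : smulC 1 = c := by simpa using smulC_bar 1

theorem smulC_bar_mul (g : FreeMetabelianGroupTwo) (r : LaurentTwo) :
    smulC (bar g * r) = g * smulC r * g⁻¹ := by
  induction r using MonoidAlgebra.induction_on with
  | of t =>
    rw [of_eq_bar, ← map_mul, smulC_bar, smulC_bar]
    group
  | add a b ha hb =>
    rw [mul_add, smulC_add, smulC_add, ha, hb]
    group
  | smul n b hb => rw [mul_smul_comm, smulC_zsmul, smulC_zsmul, hb, conj_zpow]

/-- The commutator subgroup is generated, as a module over the group ring, by the commutator of the
generators. -/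
theorem exists_smulC_eq {d : FreeMetabelianGroupTwo}
    (hd : d ∈ commutator FreeMetabelianGroupTwo) : ∃ r, smulC r = d := by
  let N : Subgroup FreeMetabelianGroupTwo :=
    { carrier := Set.range smulC
      one_mem' := ⟨0, smulC_zero⟩
      mul_mem' := by
        rintro _ _ ⟨r, rfl⟩ ⟨s, rfl⟩
        exact ⟨r + s, smulC_add r s⟩
      inv_mem' := by
        rintro _ ⟨r, rfl⟩
        exact ⟨-r, smulC_neg r⟩ }
  have hN : N.Normal := ⟨by
    rintro _ ⟨r, rfl⟩ g
    exact ⟨_, smulC_bar_mul g r⟩⟩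
  let q := QuotientGroup.mk' N
  have hxy : Commute (q x) (q y) := by
    rw [← commutatorElement_eq_one_iff_commute, ← map_commutatorElement]
    exact (QuotientGroup.eq_one_iff _).mpr ⟨1, smulC_one⟩
  have central : ∀ g, Commute (q x) (q g) ∧ Commute (q y) (q g) := by
    have h1 : (Subgroup.centralizer {q x}).comap q = ⊤ := eq_top_of_mem
      (by simp [Subgroup.mem_centralizer_singleton_iff])
      (by simpa [Subgroup.mem_centralizer_singleton_iff] using hxy.eq.symm)
    have h2 : (Subgroup.centralizer {q y}).comap q = ⊤ := eq_top_of_mem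
      (by simpa [Subgroup.mem_centralizer_singleton_iff] using hxy.eq)
      (by simp [Subgroup.mem_centralizer_singleton_iff])
    intro g
    have h1g := h1 ▸ Subgroup.mem_top g
    have h2g := h2 ▸ Subgroup.mem_top g
    rw [Subgroup.mem_comap, Subgroup.mem_centralizer_singleton_iff] at h1g h2g
    exact ⟨h1g.symm, h2g.symm⟩
  have comm : ∀ g h, Commute (q g) (q h) := by
    intro g
    have : (Subgroup.centralizer {q g}).comap q = ⊤ := eq_top_of_mem
      (by simpa [Subgroup.mem_centralizer_singleton_iff] using (central g).1.eq)
      (by simpa [Subgroup.mem_centralizer_singleton_iff] using (central g).2.eq)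
    intro h
    have hh := this ▸ Subgroup.mem_top h
    rw [Subgroup.mem_comap, Subgroup.mem_centralizer_singleton_iff] at hh
    exact hh.symm
  have hle : commutator FreeMetabelianGroupTwo ≤ N := by
    rw [commutator_def, Subgroup.commutator_le]
    intro g _ h _
    rw [← QuotientGroup.eq_one_iff]
    change q ⁅g, h⁆ = 1
    rw [map_commutatorElement, commutatorElement_eq_one_iff_commute]
    exact comm g h
  exact hle hd

/-- The Fox derivative is injective on the commutator subgroup, being there multiplication by
`1 - Y`. -/
theorem fox_smulC (r : LaurentTwo) : fox (smulC r) = r * (1 - LaurentTwo.Y) := by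
  have hadd : ∀ r s, fox (smulC (r + s)) = fox (smulC r) + fox (smulC s) := by
    intro r s
    rw [smulC_add, fox_mul, bar_eq_one_of_mem (smulC_mem r), one_mul]
  let f : LaurentTwo →+ LaurentTwo := AddMonoidHom.mk' (fun r => fox (smulC r)) hadd
  have hf : ∀ r, fox (smulC r) = f r := fun _ => rfl
  rw [hf]
  induction r using MonoidAlgebra.induction_on with
  | of t =>
    rw [← hf, of_eq_bar, smulC_bar, fox_conj, bar_eq_one_of_mem c_mem, c, fox_commutator]
    simp
  | add a b ha hb => rw [map_add, ha, hb, add_mul]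
  | smul n b hb => rw [map_zsmul, hb, smul_mul_assoc]

/-- If a normal subgroup contains `c ^ n`, `x ^ m` and `y ^ m`, then multiplying `c` by an element
of the ideal of level `m` gives an element of that subgroup. -/
theorem smulC_mem_of_mem_levelIdeal {K : Subgroup FreeMetabelianGroupTwo} [hK : K.Normal] {n m : ℕ}
    (hc : c ^ n ∈ K) (hx : x ^ m ∈ K) (hy : y ^ m ∈ K) {r : LaurentTwo}
    (hr : r ∈ LaurentTwo.levelIdeal n m) : smulC r ∈ K := by
  have hmul : ∀ s, smulC s ∈ K → ∀ r, smulC (s * r) ∈ K := by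
    intro s hs r
    induction r using MonoidAlgebra.induction_on with
    | of t =>
      rw [of_eq_bar, mul_comm, smulC_bar_mul]
      exact hK.conj_mem _ hs _
    | add a b ha hb =>
      rw [mul_add, smulC_add]
      exact mul_mem ha hb
    | smul k b hb =>
      rw [mul_smul_comm, smulC_zsmul]
      exact zpow_mem hb k
  have hpow : ∀ g, g ∈ K → smulC (bar g - 1) ∈ K := by
    intro g hg
    rw [smulC_sub, smulC_bar, smulC_one, mul_assoc, mul_assoc, ← mul_assoc c]
    exact mul_mem hg (hK.conj_mem _ (inv_mem hg) _)
  obtain ⟨p, q, s, rfl⟩ := LaurentTwo.mem_levelIdeal.mp hr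
  rw [smulC_add, smulC_add]
  refine mul_mem (mul_mem (hmul _ ?_ _) (hmul _ ?_ _)) (hmul _ ?_ _)
  · rw [← nsmul_one, ← natCast_zsmul, smulC_zsmul, smulC_one, zpow_natCast]
    exact hc
  · simpa using hpow _ hx
  · simpa using hpow _ hy

end FreeMetabelianGroupTwo

/-! ### Automorphisms and their action on the abelianization -/

namespace FreeMetabelianGroupTwo

/-- The matrix of the action of an automorphism on `ℤ²`. Its columns are the exponent vectors of
the images of `x` and `y`. -/
def exponentMatrix (φ : MulAut FreeMetabelianGroupTwo) : Matrix (Fin 2) (Fin 2) ℤ :=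
  !![(ab (φ x)).1.toAdd, (ab (φ y)).1.toAdd; (ab (φ x)).2.toAdd, (ab (φ y)).2.toAdd]

theorem ab_fst_apply (φ : MulAut FreeMetabelianGroupTwo) (g : FreeMetabelianGroupTwo) :
    (ab (φ g)).1.toAdd =
      (ab (φ x)).1.toAdd * (ab g).1.toAdd + (ab (φ y)).1.toAdd * (ab g).2.toAdd := by
  have : ((MonoidHom.fst _ _).comp ab).comp φ.toMonoidHom =
      ((zpowersHom _ (ab (φ x)).1).coprod (zpowersHom _ (ab (φ y)).1)).comp ab :=
    hom_ext (by simp) (by simp)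
  have := congrArg Multiplicative.toAdd (DFunLike.congr_fun this g)
  simpa [mul_comm] using this

theorem ab_snd_apply (φ : MulAut FreeMetabelianGroupTwo) (g : FreeMetabelianGroupTwo) :
    (ab (φ g)).2.toAdd =
      (ab (φ x)).2.toAdd * (ab g).1.toAdd + (ab (φ y)).2.toAdd * (ab g).2.toAdd := by
  have : ((MonoidHom.snd _ _).comp ab).comp φ.toMonoidHom =
      ((zpowersHom _ (ab (φ x)).2).coprod (zpowersHom _ (ab (φ y)).2)).comp ab :=
    hom_ext (by simp) (by simp)
  have := congrArg Multiplicative.toAdd (DFunLike.congr_fun this g)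
  simpa [mul_comm] using this

/-- The homomorphism `Aut(M) → GL₂(ℤ)` given by the action on the abelianization. -/
def autToGL : MulAut FreeMetabelianGroupTwo →* Matrix.GeneralLinearGroup (Fin 2) ℤ :=
  MonoidHom.toHomUnits
    { toFun := exponentMatrix
      map_one' := by
        ext i j
        fin_cases i <;> fin_cases j <;> simp [exponentMatrix]
      map_mul' := fun φ ψ => by
        ext i j
        fin_cases i <;> fin_cases j <;>
          simp [exponentMatrix, Matrix.mul_apply, ab_fst_apply φ (ψ _), ab_snd_apply φ (ψ _)] }

@[simp] theorem coe_autToGL (φ : MulAut FreeMetabelianGroupTwo) :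
    (autToGL φ : Matrix (Fin 2) (Fin 2) ℤ) = exponentMatrix φ := rfl

theorem autToGL_conj (g : FreeMetabelianGroupTwo) : autToGL (MulAut.conj g) = 1 := by
  ext i j
  fin_cases i <;> fin_cases j <;> simp [exponentMatrix]

/-- The endomorphism with prescribed values on the generators. -/
def endo (a b : FreeMetabelianGroupTwo) : FreeMetabelianGroupTwo →* FreeMetabelianGroupTwo :=
  lift derivedSeries_two a b

@[simp] theorem endo_x (a b : FreeMetabelianGroupTwo) : endo a b x = a := by
  exact lift_x derivedSeries_two a b

@[simp] theorem endo_y (a b : FreeMetabelianGroupTwo) : endo a b y = b := by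
  exact lift_y derivedSeries_two a b

/-- The automorphism `x ↦ x`, `y ↦ y * x`. -/
def transvectionT : MulAut FreeMetabelianGroupTwo :=
  MonoidHom.toMulEquiv (endo x (y * x)) (endo x (y * x⁻¹))
    (hom_ext (by simp) (by simp)) (hom_ext (by simp) (by simp))

/-- The automorphism `x ↦ x * y`, `y ↦ y`. -/
def transvectionU : MulAut FreeMetabelianGroupTwo :=
  MonoidHom.toMulEquiv (endo (x * y) y) (endo (x * y⁻¹) y)
    (hom_ext (by simp) (by simp)) (hom_ext (by simp) (by simp))

@[simp] theorem transvectionT_x : transvectionT x = x := endo_x x (y * x)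

@[simp] theorem transvectionT_y : transvectionT y = y * x := endo_y x (y * x)

@[simp] theorem transvectionU_x : transvectionU x = x * y := endo_x (x * y) y

@[simp] theorem transvectionU_y : transvectionU y = y := endo_y (x * y) y

open Matrix.SpecialLinearGroup in
/-- Every element of `SL₂(ℤ)` lifts to an automorphism that fixes the commutator of the
generators: the elementary matrices do. -/
theorem exists_aut_of_specialLinearGroup (A : Matrix.SpecialLinearGroup (Fin 2) ℤ) :
    ∃ φ : MulAut FreeMetabelianGroupTwo, φ c = c ∧ autToGL φ = toGL A := by
  let P : Subgroup (Matrix.SpecialLinearGroup (Fin 2) ℤ) :=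
    ((MulAction.stabilizer (MulAut FreeMetabelianGroupTwo) c).map autToGL).comap toGL
  have hT : ModularGroup.T ∈ P := by
    refine ⟨transvectionT, ?_, ?_⟩
    · change transvectionT c = c
      rw [c, map_commutatorElement, transvectionT_x, transvectionT_y]
      simp [commutatorElement_def, mul_assoc]
    · ext i j
      fin_cases i <;> fin_cases j <;> simp [exponentMatrix]
  have hU : (⟨!![1, 0; 1, 1], by simp⟩ : Matrix.SpecialLinearGroup (Fin 2) ℤ) ∈ P := by
    refine ⟨transvectionU, ?_, ?_⟩
    · change transvectionU c = c
      rw [c, map_commutatorElement, transvectionU_x, transvectionU_y]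
      simp [commutatorElement_def, mul_assoc]
    · ext i j
      fin_cases i <;> fin_cases j <;> simp [exponentMatrix] <;> rfl
  have hS : ModularGroup.S ∈ P := by
    have h : ModularGroup.T * ModularGroup.S * ModularGroup.T ∈ P := by
      have hTST : ModularGroup.T * ModularGroup.S * ModularGroup.T =
          ⟨!![1, 0; 1, 1], by simp⟩ := by
        ext i j
        fin_cases i <;> fin_cases j <;> rfl
      rwa [hTST]
    exact (P.mul_mem_cancel_left hT).mp ((P.mul_mem_cancel_right hT).mp h)
  have hP : P = ⊤ := by
    rw [eq_top_iff, ← SpecialLinearGroup.SL2Z_generators, Subgroup.closure_le]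
    rintro _ (rfl | rfl)
    · exact hS
    · exact hT
  have hA : A ∈ P := hP ▸ Subgroup.mem_top A
  exact hA

theorem exists_eq_mul_pow_mul_smulC {z w : FreeMetabelianGroupTwo} {t : FreeAbelianTwo} {N : ℕ}
    (h : ab w = ab z * t ^ N) : ∃ g r, w = z * g ^ N * smulC r := by
  have hd : (z * abSection t ^ N)⁻¹ * w ∈ commutator FreeMetabelianGroupTwo := by
    rw [← ker_ab, MonoidHom.mem_ker]
    simp [h]
  obtain ⟨r, hr⟩ := exists_smulC_eq hd
  exact ⟨abSection t, r, by rw [hr, mul_inv_cancel_left]⟩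

/-- High powers have trivial Fox derivative at finite level. -/
theorem fox_pow_mem_levelIdeal (g : FreeMetabelianGroupTwo) (n m : ℕ) :
    fox (g ^ (n * m)) ∈ LaurentTwo.levelIdeal n m := by
  rw [fox_pow]
  exact Ideal.mul_mem_right _ _
    (LaurentTwo.geom_sum_mem_levelIdeal n m (LaurentTwo.of_pow_sub_one_mem_levelIdeal n m _))

theorem bar_pow_sub_one_mem_levelIdeal (g : FreeMetabelianGroupTwo) (n m : ℕ) :
    bar g ^ (n * m) - 1 ∈ LaurentTwo.levelIdeal n m :=
  LaurentTwo.levelIdeal_le_of_dvd n (Dvd.intro_left n rfl)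
    (LaurentTwo.of_pow_sub_one_mem_levelIdeal n (n * m) _)

/-- An endomorphism fixing `c` that is congruent to the identity on the abelianization satisfies a
Koszul relation, obtained by differentiating `⁅φ x, φ y⁆ = c`. -/
theorem koszul_relation_of_commutator_eq {n m : ℕ} {g h : FreeMetabelianGroupTwo} {a b : LaurentTwo}
    (hc : ⁅x * g ^ (n * m) * smulC a, y * h ^ (n * m) * smulC b⁆ = c) :
    (LaurentTwo.Y - 1) * ((LaurentTwo.Y - 1) * (LaurentTwo.X * a)
      + (LaurentTwo.X - 1) * -(LaurentTwo.Y * b)) ∈ LaurentTwo.levelIdeal n m := by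
  have hfox := congrArg fox hc
  rw [fox_commutator, c, fox_commutator] at hfox
  simp only [fox_mul, fox_smulC, map_mul, bar_eq_one_of_mem (smulC_mem _), fox_x, fox_y, bar_x,
    bar_y] at hfox
  have hg := fox_pow_mem_levelIdeal g n m
  have hh := fox_pow_mem_levelIdeal h n m
  have hg' := bar_pow_sub_one_mem_levelIdeal g n m
  have hh' := bar_pow_sub_one_mem_levelIdeal h n m
  rw [← map_pow] at hg' hh'
  rw [← Ideal.Quotient.eq_zero_iff_mem] at hg hh hg' hh' ⊢
  rw [map_sub, map_one, sub_eq_zero] at hg' hh'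
  have hq := congrArg (Ideal.Quotient.mk (LaurentTwo.levelIdeal n m)) hfox
  simp only [map_add, map_sub, map_mul, map_one, map_neg, map_zero, hg, hh, hg', hh'] at hq ⊢
  linear_combination hq

/-- A solution of the Koszul relation at `z` makes `φ z` agree, modulo `K`, with the conjugate of
`z` by `smulC r`. -/
theorem inv_mul_conj_mem {K : Subgroup FreeMetabelianGroupTwo} [hK : K.Normal]
    {z k : FreeMetabelianGroupTwo} {a r : LaurentTwo} (hk : k ∈ K)
    (h : smulC (bar z * a + (bar z - 1) * r) ∈ K) :
    z⁻¹ * ((smulC r)⁻¹ * (z * k * smulC a) * smulC r) ∈ K := by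
  rw [sub_one_mul, smulC_add, smulC_sub, smulC_bar_mul, smulC_bar_mul] at h
  rw [← QuotientGroup.eq_one_iff] at h hk ⊢
  simp only [QuotientGroup.mk_mul, QuotientGroup.mk_inv, hk, mul_one] at h ⊢
  have h2 : (z : FreeMetabelianGroupTwo ⧸ K) * smulC a * smulC r = smulC r * z := by
    rw [← mul_inv_eq_one, ← h]
    group
  rw [inv_mul_eq_one, mul_assoc, h2, inv_mul_cancel_left]

theorem mem_principalCongruenceSubgroup_of {K : Subgroup FreeMetabelianGroupTwo}
    [K.Characteristic] {φ : MulAut FreeMetabelianGroupTwo} (hx : x⁻¹ * φ x ∈ K)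
    (hy : y⁻¹ * φ y ∈ K) : φ ∈ principalCongruenceSubgroup K := by
  have h : (QuotientGroup.mk' K).comp φ.toMonoidHom = QuotientGroup.mk' K :=
    hom_ext (QuotientGroup.eq.mpr hx).symm (QuotientGroup.eq.mpr hy).symm
  rw [principalCongruenceSubgroup, MonoidHom.mem_ker]
  ext b
  obtain ⟨b, rfl⟩ := QuotientGroup.mk_surjective b
  exact DFunLike.congr_fun h b

/-- The image of a principal congruence subgroup of `Aut(M)` in `GL₂(ℤ)` contains a principal
congruence subgroup of `SL₂(ℤ)`. -/
theorem exists_Gamma_le_map_principalCongruenceSubgroup (K : Subgroup FreeMetabelianGroupTwo)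
    [K.Characteristic] [K.FiniteIndex] :
    ∃ N, 0 < N ∧ ∀ A ∈ CongruenceSubgroup.Gamma N,
      ∃ φ ∈ principalCongruenceSubgroup K, autToGL φ = Matrix.SpecialLinearGroup.toGL A := by
  have he : 0 < K.index := Nat.pos_of_ne_zero Subgroup.FiniteIndex.index_ne_zero
  have hK : ∀ g, g ^ K.index ∈ K := fun g => K.pow_index_mem g
  generalize K.index = e at he hK
  -- One factor `e` is spent on the Fox derivatives of `N`-th powers, one on the cancellation of
  -- `Y - 1` and one on the Koszul relation; level `e` is where `smulC` of the ideal lies in `K`.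
  refine ⟨e * (e * (e * e)), by positivity, fun A hA => ?_⟩
  have hNK : ∀ g, g ^ (e * (e * (e * e))) ∈ K := fun g => by
    rw [pow_mul]
    exact pow_mem (hK g) _
  obtain ⟨φ, hφc, hφA⟩ := exists_aut_of_specialLinearGroup A
  have hent : ∀ i j, exponentMatrix φ i j = A i j := fun i j =>
    congrArg (fun B : Matrix.GeneralLinearGroup (Fin 2) ℤ => (B : Matrix _ _ ℤ) i j) hφA
  rw [CongruenceSubgroup.Gamma_mem] at hA
  obtain ⟨h00, h01, h10, h11⟩ := hA
  have hdvd : ∀ k l : ℤ, ((k : ZMod (e * (e * (e * e)))) = l) →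
      ∃ t, k = l + ((e * (e * (e * e)) : ℕ) : ℤ) * t := fun k l hkl => by
    obtain ⟨t, ht⟩ := (ZMod.intCast_eq_intCast_iff_dvd_sub l k _).mp hkl.symm
    exact ⟨t, by rw [← ht]; ring⟩
  obtain ⟨t00, h00⟩ := hdvd _ 1 (by simpa using h00)
  obtain ⟨t01, h01⟩ := hdvd _ 0 (by simpa using h01)
  obtain ⟨t10, h10⟩ := hdvd _ 0 (by simpa using h10)
  obtain ⟨t11, h11⟩ := hdvd _ 1 (by simpa using h11)
  rw [← hent] at h00 h01 h10 h11
  obtain ⟨g, a, hg⟩ : ∃ g a, φ x = x * g ^ (e * (e * (e * e))) * smulC a := by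
    refine exists_eq_mul_pow_mul_smulC (t := (.ofAdd t00, .ofAdd t10)) ?_
    refine Prod.ext (Multiplicative.toAdd.injective ?_) (Multiplicative.toAdd.injective ?_)
    · simpa [exponentMatrix] using h00
    · simpa [exponentMatrix] using h10
  obtain ⟨h, b, hh⟩ : ∃ h b, φ y = y * h ^ (e * (e * (e * e))) * smulC b := by
    refine exists_eq_mul_pow_mul_smulC (t := (.ofAdd t01, .ofAdd t11)) ?_
    refine Prod.ext (Multiplicative.toAdd.injective ?_) (Multiplicative.toAdd.injective ?_)
    · simpa [exponentMatrix] using h01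
    · simpa [exponentMatrix] using h11
  have hrel :
      ⁅x * g ^ (e * (e * (e * e))) * smulC a, y * h ^ (e * (e * (e * e))) * smulC b⁆ = c := by
    rw [← hg, ← hh, ← map_commutatorElement]
    exact hφc
  obtain ⟨r, hra, hrb⟩ := LaurentTwo.exists_of_koszul_relation_mem
    (LaurentTwo.mem_levelIdeal_of_Y_sub_one_mul_mem (koszul_relation_of_commutator_eq hrel))
  have hmem : ∀ s ∈ LaurentTwo.levelIdeal e e, smulC s ∈ K := fun s hs =>
    smulC_mem_of_mem_levelIdeal (hK c) (hK x) (hK y) hs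
  refine ⟨MulAut.conj (smulC r)⁻¹ * φ, mem_principalCongruenceSubgroup_of ?_ ?_, ?_⟩
  · rw [MulAut.mul_apply, MulAut.conj_apply, hg, inv_inv]
    refine inv_mul_conj_mem (hNK g) (hmem _ ?_)
    rwa [bar_x]
  · rw [MulAut.mul_apply, MulAut.conj_apply, hh, inv_inv]
    refine inv_mul_conj_mem (hNK h) (hmem _ ?_)
    rw [bar_y, ← neg_mem_iff]
    convert hrb using 1
    ring
  · rw [map_mul, autToGL_conj, one_mul, hφA]

end FreeMetabelianGroupTwo

/-! ### A noncongruence subgroup of `SL₂(ℤ)` -/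

namespace Sanov

open Matrix.SpecialLinearGroup CongruenceSubgroup

/-- The unipotent matrices `!![1, 2; 0, 1]` and `!![1, 0; 2, 1]`. -/
def gen : Fin 2 → Matrix.SpecialLinearGroup (Fin 2) ℤ :=
  ![⟨!![1, 2; 0, 1], by simp⟩, ⟨!![1, 0; 2, 1], by simp⟩]

/-- The homomorphism from the free group whose image is Sanov's subgroup. -/
def hom : FreeGroup (Fin 2) →* Matrix.SpecialLinearGroup (Fin 2) ℤ := FreeGroup.lift gen

theorem gen_zero_mul (A : Matrix.SpecialLinearGroup (Fin 2) ℤ) :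
    (gen 0 * A) 0 0 = A 0 0 + 2 * A 1 0 ∧ (gen 0 * A) 1 0 = A 1 0 := by
  constructor <;>
    · rw [coe_mul]
      simp [gen, Matrix.mul_apply, Fin.sum_univ_two]

theorem gen_one_mul (A : Matrix.SpecialLinearGroup (Fin 2) ℤ) :
    (gen 1 * A) 0 0 = A 0 0 ∧ (gen 1 * A) 1 0 = 2 * A 0 0 + A 1 0 := by
  constructor <;>
    · rw [coe_mul]
      simp [gen, Matrix.mul_apply, Fin.sum_univ_two]

theorem gen_zero_inv_mul (A : Matrix.SpecialLinearGroup (Fin 2) ℤ) :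
    ((gen 0)⁻¹ * A) 0 0 = A 0 0 - 2 * A 1 0 ∧ ((gen 0)⁻¹ * A) 1 0 = A 1 0 := by
  obtain ⟨h0, h1⟩ := gen_zero_mul ((gen 0)⁻¹ * A)
  rw [mul_inv_cancel_left] at h0 h1
  constructor <;> linarith

theorem gen_one_inv_mul (A : Matrix.SpecialLinearGroup (Fin 2) ℤ) :
    ((gen 1)⁻¹ * A) 0 0 = A 0 0 ∧ ((gen 1)⁻¹ * A) 1 0 = A 1 0 - 2 * A 0 0 := by
  obtain ⟨h0, h1⟩ := gen_one_mul ((gen 1)⁻¹ * A)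
  rw [mul_inv_cancel_left] at h0 h1
  constructor <;> linarith

theorem sq_fst_col_pos (A : Matrix.SpecialLinearGroup (Fin 2) ℤ) :
    0 < A 0 0 ^ 2 + A 1 0 ^ 2 := by
  have hdet := A.det_coe
  rw [Matrix.det_fin_two] at hdet
  rcases eq_or_ne (A 0 0) 0 with h | h
  · rcases eq_or_ne (A 1 0) 0 with h' | h'
    · simp [h, h'] at hdet
    · positivity
  · positivity

/-- Sanov's theorem. The four sets of the ping-pong argument cut the projective line into the
intervals `[1, ∞]`, `[0, 1)`, `(-∞, -1)` and `[-1, 0)`, for the ratio `p / q` of the entries of the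
first column. -/
theorem hom_injective : Function.Injective hom := by
  refine FreeGroup.injective_lift_of_ping_pong (α := Matrix.SpecialLinearGroup (Fin 2) ℤ) gen
    ![{A | A 1 0 ^ 2 ≤ A 0 0 * A 1 0}, {A | 0 ≤ A 0 0 * A 1 0 ∧ A 0 0 * A 1 0 < A 1 0 ^ 2}]
    ![{A | A 0 0 * A 1 0 < -A 1 0 ^ 2}, {A | -A 1 0 ^ 2 ≤ A 0 0 * A 1 0 ∧ A 0 0 * A 1 0 < 0}]
    ?_ ?_ ?_ ?_ ?_ ?_
  · intro i
    fin_cases i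
    · exact ⟨1, by simp⟩
    · refine ⟨⟨!![0, -1; 1, 0], by simp⟩, ?_⟩
      change (0 : ℤ) ≤ 0 * 1 ∧ (0 : ℤ) * 1 < 1 ^ 2
      simp
  · intro i j hij
    fin_cases i <;> fin_cases j <;> first | exact absurd rfl hij | skip
    all_goals
      refine Set.disjoint_left.mpr fun A h1 h2 => ?_
      simp at h1 h2
      linarith [h1, h2]
  · intro i j hij
    fin_cases i <;> fin_cases j <;> first | exact absurd rfl hij | skip
    all_goals
      refine Set.disjoint_left.mpr fun A h1 h2 => ?_
      simp at h1 h2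
      linarith [h1, h2]
  · intro i j
    fin_cases i <;> fin_cases j
    all_goals
      refine Set.disjoint_left.mpr fun A h1 h2 => ?_
      have := sq_nonneg (A 1 0)
      simp at h1 h2
      linarith [h1, h2]
  · intro i
    fin_cases i
    · rintro _ ⟨A, hA, rfl⟩
      obtain ⟨h0, h1⟩ := gen_zero_mul A
      simp at hA
      simp [h0, h1]
      nlinarith
    · rintro _ ⟨A, hA, rfl⟩
      obtain ⟨h0, h1⟩ := gen_one_mul A
      have hpos := sq_fst_col_pos A
      simp only [Fin.mk_one, Matrix.cons_val_one, Matrix.cons_val_fin_one, Set.mem_compl_iff,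
        Set.mem_ofPred_eq, not_and, not_lt, smul_eq_mul, h0, h1] at hA ⊢
      generalize A 0 0 = p at *
      generalize A 1 0 = q at *
      rcases lt_or_ge (p * q) (-q ^ 2) with h | h
      · constructor <;> nlinarith [sq_nonneg (p + q), sq_nonneg q]
      · have := hA h
        constructor <;> nlinarith [sq_nonneg p]
  · intro i
    fin_cases i
    · rintro _ ⟨A, hA, rfl⟩
      obtain ⟨h0, h1⟩ := gen_zero_inv_mul A
      simp at hA
      simp [h0, h1]
      nlinarith
    · rintro _ ⟨A, hA, rfl⟩
      obtain ⟨h0, h1⟩ := gen_one_inv_mul A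
      have hpos := sq_fst_col_pos A
      simp only [Fin.mk_one, Matrix.cons_val_one, Matrix.cons_val_fin_one, Set.mem_compl_iff,
        Set.mem_ofPred_eq, not_and, not_lt, Pi.inv_apply, smul_eq_mul, h0, h1] at hA ⊢
      generalize A 0 0 = p at *
      generalize A 1 0 = q at *
      rcases lt_or_ge (p * q) 0 with h | h
      · constructor <;> nlinarith [sq_nonneg p]
      · have := hA h
        constructor <;> nlinarith [sq_nonneg (p - q), sq_nonneg q]

theorem gen_zero_eq : gen 0 = ModularGroup.T ^ (2 : ℤ) := by
  ext i j
  rw [ModularGroup.coe_T_zpow]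
  rfl

theorem coe_gen_zero_zpow (k : ℤ) :
    (gen 0 ^ k : Matrix.SpecialLinearGroup (Fin 2) ℤ).1 = !![1, 2 * k; 0, 1] := by
  rw [gen_zero_eq, ← zpow_mul]
  exact ModularGroup.coe_T_zpow _

theorem gen_mem_range (i : Fin 2) : gen i ∈ hom.range :=
  ⟨FreeGroup.of i, FreeGroup.lift_apply_of ..⟩

theorem mem_Gamma_two_iff {A : Matrix.SpecialLinearGroup (Fin 2) ℤ} :
    A ∈ Gamma 2 ↔ A 0 0 % 2 = 1 ∧ A 0 1 % 2 = 0 ∧ A 1 0 % 2 = 0 ∧ A 1 1 % 2 = 1 := by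
  have h0 : ∀ k : ℤ, (k : ZMod 2) = 0 ↔ k % 2 = 0 := fun k => by
    rw [ZMod.intCast_zmod_eq_zero_iff_dvd]
    omega
  have h1 : ∀ k : ℤ, (k : ZMod 2) = 1 ↔ k % 2 = 1 := fun k => by
    rw [← sub_eq_zero, ← Int.cast_one, ← Int.cast_sub, h0]
    omega
  rw [Gamma_mem, h0, h0, h1, h1]

theorem gen_mem_Gamma_two (i : Fin 2) : gen i ∈ Gamma 2 := by
  rw [mem_Gamma_two_iff]
  fin_cases i <;> exact ⟨rfl, rfl, rfl, rfl⟩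

/-- Sanov's subgroup has index two in `Γ(2)`, and `-1` represents the other coset: the Euclidean
algorithm applied to the first column, whose entries have different parity, reaches `(±1, 0)`. -/
theorem mem_range_or_neg_mem_range {A : Matrix.SpecialLinearGroup (Fin 2) ℤ} (hA : A ∈ Gamma 2) :
    A ∈ hom.range ∨ -A ∈ hom.range := by
  induction hn : (A 0 0).natAbs + (A 1 0).natAbs using Nat.strong_induction_on generalizing A with
  | _ n ih =>
    subst hn
    have step : ∀ g ∈ hom.range, g ∈ Gamma 2 →
        ((g * A) 0 0).natAbs + ((g * A) 1 0).natAbs < (A 0 0).natAbs + (A 1 0).natAbs →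
        A ∈ hom.range ∨ -A ∈ hom.range := by
      intro g hg hg2 hlt
      have := ih _ hlt (mul_mem hg2 hA) rfl
      rwa [← mul_neg, Subgroup.mul_mem_cancel_left _ hg, Subgroup.mul_mem_cancel_left _ hg] at this
    obtain ⟨h00, h01, h10, h11⟩ := mem_Gamma_two_iff.mp hA
    rcases eq_or_ne (A 1 0) 0 with hq | hq
    · have hdet := A.det_coe
      rw [Matrix.det_fin_two, hq, mul_zero, sub_zero] at hdet
      have hk : ∃ k, A 0 1 = 2 * k := ⟨A 0 1 / 2, by omega⟩
      obtain ⟨k, hk⟩ := hk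
      rcases Int.mul_eq_one_iff_eq_one_or_neg_one.mp hdet with ⟨h0, h1⟩ | ⟨h0, h1⟩
      · left
        have : A = gen 0 ^ k := by
          apply Subtype.ext
          rw [coe_gen_zero_zpow, Matrix.eta_fin_two A.1, h0, h1, hq, hk]
        exact this ▸ zpow_mem (gen_mem_range 0) k
      · right
        have : -A = gen 0 ^ (-k) := by
          apply Subtype.ext
          change -A.1 = _
          rw [coe_gen_zero_zpow, Matrix.eta_fin_two A.1, h0, h1, hq, hk]
          simp
        exact this ▸ zpow_mem (gen_mem_range 0) (-k)
    · have hcases : (A 0 0 + 2 * A 1 0).natAbs < (A 0 0).natAbs ∨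
          (A 0 0 - 2 * A 1 0).natAbs < (A 0 0).natAbs ∨
          (2 * A 0 0 + A 1 0).natAbs < (A 1 0).natAbs ∨
          (A 1 0 - 2 * A 0 0).natAbs < (A 1 0).natAbs := by omega
      rcases hcases with h | h | h | h
      · refine step _ (gen_mem_range 0) (gen_mem_Gamma_two 0) ?_
        rw [(gen_zero_mul A).1, (gen_zero_mul A).2]
        omega
      · refine step _ (inv_mem (gen_mem_range 0)) (inv_mem (gen_mem_Gamma_two 0)) ?_
        rw [(gen_zero_inv_mul A).1, (gen_zero_inv_mul A).2]
        omega
      · refine step _ (gen_mem_range 1) (gen_mem_Gamma_two 1) ?_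
        rw [(gen_one_mul A).1, (gen_one_mul A).2]
        omega
      · refine step _ (inv_mem (gen_mem_range 1)) (inv_mem (gen_mem_Gamma_two 1)) ?_
        rw [(gen_one_inv_mul A).1, (gen_one_inv_mul A).2]
        omega

theorem finiteIndex_range : hom.range.FiniteIndex := by
  rw [Subgroup.finiteIndex_iff_finite_quotient]
  let f : (Matrix.SpecialLinearGroup (Fin 2) ℤ ⧸ Gamma 2) × Bool →
      Matrix.SpecialLinearGroup (Fin 2) ℤ ⧸ hom.range :=
    fun t => QuotientGroup.mk (if t.2 then t.1.out else -t.1.out)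
  refine Finite.of_surjective f fun q => ?_
  obtain ⟨A, rfl⟩ := QuotientGroup.mk_surjective q
  have hmem : (Quotient.out (A : Matrix.SpecialLinearGroup (Fin 2) ℤ ⧸ Gamma 2))⁻¹ * A ∈ Gamma 2 :=
    QuotientGroup.eq.mp (QuotientGroup.out_eq' _)
  rcases mem_range_or_neg_mem_range hmem with h | h
  · exact ⟨(A, true), QuotientGroup.eq.mpr h⟩
  · refine ⟨(A, false), QuotientGroup.eq.mpr ?_⟩
    simpa using h

/-- The character of the free group sending the first generator to `1` and the second to `0`
modulo `5`. -/
def character : FreeGroup (Fin 2) →* Multiplicative (ZMod 5) :=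
  FreeGroup.lift ![Multiplicative.ofAdd 1, 1]

/-- The kernel of the character modulo `5` of Sanov's subgroup. -/
def noncongruenceSubgroup : Subgroup (Matrix.SpecialLinearGroup (Fin 2) ℤ) := character.ker.map hom

theorem finiteIndex_noncongruenceSubgroup : noncongruenceSubgroup.FiniteIndex := by
  rw [Subgroup.finiteIndex_iff, noncongruenceSubgroup, Subgroup.index_map]
  have : (character.ker ⊔ hom.ker).FiniteIndex := Subgroup.finiteIndex_of_le le_sup_left
  exact mul_ne_zero this.index_ne_zero finiteIndex_range.index_ne_zero

/-- Modulo `m`, a matrix congruent to `diag(u, u⁻¹)` conjugates `gen 0` to its `u ^ 2`-th power. -/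
theorem conj_gen_zero_mem_Gamma {m : ℕ} {A : Matrix.SpecialLinearGroup (Fin 2) ℤ}
    (h01 : (A 0 1 : ZMod m) = 0) (h10 : (A 1 0 : ZMod m) = 0) :
    A * gen 0 * (gen 0 ^ (A 0 0 ^ 2) * A)⁻¹ ∈ Gamma m := by
  have hdet : (A 0 0 : ZMod m) * A 1 1 = 1 := by
    have := congrArg (Int.cast : ℤ → ZMod m) A.det_coe
    rw [Matrix.det_fin_two] at this
    push_cast at this
    rwa [h01, zero_mul, sub_zero] at this
  rw [Gamma_mem', map_mul, map_inv, mul_inv_eq_one]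
  apply Subtype.ext
  have e1 : (A * gen 0).1 = A.1 * !![1, 2; 0, 1] := rfl
  have e2 : (gen 0 ^ (A 0 0 ^ 2) * A).1 = !![1, 2 * A 0 0 ^ 2; 0, 1] * A.1 := by
    rw [← coe_gen_zero_zpow]
    rfl
  change (A * gen 0).1.map _ = (gen 0 ^ (A 0 0 ^ 2) * A).1.map _
  rw [e1, e2, Matrix.eta_fin_two A.1]
  ext i j
  fin_cases i <;> fin_cases j <;> simp [h01, h10]
  linear_combination (-2 * A 0 0 : ZMod m) * hdet

theorem not_Gamma_le_noncongruenceSubgroup {m : ℕ} (hm : 0 < m) :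
    ¬ Gamma m ≤ noncongruenceSubgroup := by
  intro hle
  -- A unit modulo `10 * m` that is `2` modulo `5`.
  have : NeZero (10 * m) := ⟨by omega⟩
  have h5 : 5 ∣ 10 * m := ⟨2 * m, by ring⟩
  obtain ⟨v, hv⟩ := ZMod.unitsMap_surjective h5 (ZMod.unitOfCoprime 2 (by norm_num))
  have hcop := ZMod.val_coe_unit_coprime v
  have hu5 : (((v : ZMod (10 * m)).val : ℤ) : ZMod 5) = 2 := by
    have := congrArg Units.val hv
    rw [ZMod.unitsMap_val, ZMod.cast_eq_val] at this
    simpa using this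
  generalize (v : ZMod (10 * m)).val = u at hcop hu5
  have hcop' : IsCoprime (u : ℤ) (((10 * m : ℕ) : ℤ) ^ 2) :=
    (Nat.isCoprime_iff_coprime.mpr hcop).pow_right
  obtain ⟨d, b, hdb⟩ := hcop'
  let g : Matrix.SpecialLinearGroup (Fin 2) ℤ :=
    ⟨!![(u : ℤ), (10 * m : ℕ); -b * (10 * m : ℕ), d], by
      rw [Matrix.det_fin_two_of]
      linear_combination hdb⟩
  have hg2 : g ∈ Gamma 2 := by
    have hu2 : (u : ℤ) % 2 = 1 := by
      have : u.Coprime 2 := hcop.coprime_dvd_right ⟨5 * m, by ring⟩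
      have := Nat.coprime_two_right.mp this
      have := Nat.odd_iff.mp this
      omega
    have hd : d % 2 = 1 := by
      refine Int.emod_two_ne_zero.mp fun hd => ?_
      obtain ⟨k, rfl⟩ := Int.dvd_of_emod_eq_zero hd
      push_cast at hdb
      have : 2 * (k * u + b * (50 * m ^ 2)) = 1 := by linear_combination hdb
      omega
    rw [mem_Gamma_two_iff]
    refine ⟨hu2, ?_, ?_, hd⟩
    · change ((10 * m : ℕ) : ℤ) % 2 = 0
      omega
    · change (-b * (10 * m : ℕ) : ℤ) % 2 = 0
      exact Int.emod_eq_zero_of_dvd ⟨-b * (5 * m), by push_cast; ring⟩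
  have hgm : g * gen 0 * (gen 0 ^ ((u : ℤ) ^ 2) * g)⁻¹ ∈ Gamma m := by
    refine conj_gen_zero_mem_Gamma ?_ ?_
    · change (((10 * m : ℕ) : ℤ) : ZMod m) = 0
      simp
    · change ((-b * (10 * m : ℕ) : ℤ) : ZMod m) = 0
      simp
  obtain ⟨s, hs⟩ : ∃ s, hom s * gen 0 * (gen 0 ^ ((u : ℤ) ^ 2) * hom s)⁻¹ ∈ Gamma m := by
    rcases mem_range_or_neg_mem_range hg2 with ⟨s, hs⟩ | ⟨s, hs⟩
    · exact ⟨s, hs ▸ hgm⟩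
    · refine ⟨s, ?_⟩
      rw [hs]
      simpa using hgm
  have h0 : gen 0 = hom (FreeGroup.of 0) := (FreeGroup.lift_apply_of ..).symm
  have hL := hle hs
  rw [h0, ← map_zpow, ← map_mul, ← map_mul, ← map_inv, ← map_mul, noncongruenceSubgroup,
    Subgroup.mem_map_iff_mem hom_injective, MonoidHom.mem_ker] at hL
  have hχ := congrArg Multiplicative.toAdd hL
  have h1 : (1 : ZMod 5) - u ^ 2 = 0 := by
    simp [character] at hχ
    linear_combination hχ
  rw [Int.cast_natCast] at hu5
  rw [hu5] at h1
  exact absurd h1 (by decide)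

end Sanov

/-! ### Failure of the congruence subgroup property -/

open Matrix.SpecialLinearGroup in
/-- `SL₂(ℤ)` has finite index in `GL₂(ℤ)`, so its finite index subgroups do too. -/
theorem finiteIndex_map_toGL {L : Subgroup (Matrix.SpecialLinearGroup (Fin 2) ℤ)}
    (hL : L.FiniteIndex) : (L.map (toGL (n := Fin 2) (R := ℤ))).FiniteIndex := by
  have hrange : (toGL (n := Fin 2) (R := ℤ)).range.FiniteIndex := by
    have hker : (Matrix.GeneralLinearGroup.det (n := Fin 2) (R := ℤ)).ker.FiniteIndex :=
      inferInstance
    refine Subgroup.finiteIndex_of_le (H := Matrix.GeneralLinearGroup.det.ker) fun A hA => ?_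
    refine ⟨⟨A, congrArg Units.val hA⟩, ?_⟩
    ext i j
    rfl
  rw [Subgroup.finiteIndex_iff, Subgroup.index_map]
  have : (L ⊔ toGL.ker).FiniteIndex := Subgroup.finiteIndex_of_le le_sup_left
  exact mul_ne_zero this.index_ne_zero hrange.index_ne_zero

theorem mainTheorem12 : ¬ AutHasCongruenceSubgroupProperty FreeMetabelianGroupTwo := by
  intro h
  let L := Sanov.noncongruenceSubgroup.map Matrix.SpecialLinearGroup.toGL
  have hL : L.FiniteIndex := finiteIndex_map_toGL Sanov.finiteIndex_noncongruenceSubgroup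
  have hcomap : (L.comap FreeMetabelianGroupTwo.autToGL).FiniteIndex := by
    rw [Subgroup.finiteIndex_iff, Subgroup.index_comap]
    exact (Subgroup.isFiniteRelIndex_of_finiteIndex (h := hL)).relIndex_ne_zero
  obtain ⟨K, _, _, hK⟩ := h (L.comap FreeMetabelianGroupTwo.autToGL) hcomap
  obtain ⟨N, hN, hΓ⟩ :=
    FreeMetabelianGroupTwo.exists_Gamma_le_map_principalCongruenceSubgroup K
  refine Sanov.not_Gamma_le_noncongruenceSubgroup hN fun A hA => ?_
  obtain ⟨φ, hφ, hφA⟩ := hΓ A hA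
  have hmem : FreeMetabelianGroupTwo.autToGL φ ∈ L := hK hφ
  rw [hφA] at hmem
  exact (Subgroup.mem_map_iff_mem Matrix.SpecialLinearGroup.toGL_injective).mp hmem
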